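/- Let $d\ge 1$, $b\in\mathbb{R}^d$, let $\mathbb{A}$ be a symmetric nonnegative definite $d\times d$ matrix, and let $\phi:\mathbb{R}^d\to[0,\infty]$ be measurable with $\int_{\mathbb{R}^d}\frac{|y|^2}{1+|y|^2}\,\phi(y)\,dy<\infty$. Let $B$ be the unit ball centered at the origin. A Lévy process started at $x$ has characteristics $(b,\mathbb{A},\nu)$ if $E^x[e^{i\xi\cdot X_t}]=e^{-t\Psi(\xi)+i\xi\cdot x}$ for all $t\ge 0$ and $\xi\in\mathbb{R}^d$, where $$\Psi(\xi)=-i\langle b,\xi\rangle+\tfrac12\langle\mathbb{A}\xi,\xi\rangle+\int_{\mathbb{R}^d}\left[1+i\langle\xi,y\rangle\mathbb{I}_B(y)-e^{i\xi\cdot y}\right]d\nu(y).$$ For measurable $f:\mathbb{R}^d\to[0,\infty]$ let $f^*$ be its symmetric decreasing rearrangement, $f^*(x)=\int_0^\infty \mathbb{I}_{\{f>s\}^*}(x)\,ds$, where $S^*$ is the open ball centered at $0$ with the same Lebesgue measure as $S$. For a nonnegative definite matrix $M$ put $M^*=(\det M)^{1/d}I_d$. Let $X_t$ be a Lévy process with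 characteristics $(b,\mathbb{A},\phi(y)\,dy)$ and $X^*_t$ a Lévy process with characteristics $(0,\mathbb{A}^*,\phi^*(y)\,dy)$. Let $\epsilon_n>0$ with $\epsilon_n\to0$, and for $n\ge1$ put $$\phi_n(y)=\phi(y)\,\mathbb{I}_{\{|y|>1/n\}},\qquad \mathbb{A}_n=\mathbb{A}+\epsilon_nI_d,\qquad b_n=b-\int_B y\,\phi_n(y)\,dy.$$ Let $X_{n,t}=C_{n,t}+G_{n,t}$, where $C_{n,t}$ is a compound Poisson process started at $0$ with Lévy measure $\phi_n(y)\,dy$, and $G_{n,t}$ is a Gaussian Lévy process, independent of $C_{n,t}$, whose law at time $t$ under $P^x$ is normal with mean $x+tb_n$ and covariance matrix $t\mathbb{A}_n$. Let $X^*_{n,t}=C^*_{n,t}+G^*_{n,t}$, where $C^*_{n,t}$ is a compound Poisson process started at $0$ with Lévy measure $\phi_n^*(y)\,dy$ (with $\phi_n^*=(\phi_n)^*$), and $G^*_{n,t}$ is a Gaussian Lévy process, independent of $C^*_{n,t}$, whose law at time $t$ under $P^x$ is normal with mean $x$ and covariance matrix $t\mathbb{A}_n^*$. **Theorem.** Let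 $f_1,\dots,f_m$ be nonnegative bounded continuous functions on $\mathbb{R}^d$ and $0<t_1<\dots<t_m$. Then for all $x\in\mathbb{R}^d$, $$\lim_{n\to\infty}E^x\left[\prod_{i=1}^m f_i(X_{n,t_i})\right]=E^x\left[\prod_{i=1}^m f_i(X_{t_i})\right]$$ and $$\lim_{n\to\infty}E^x\left[\prod_{i=1}^m f_i(X^*_{n,t_i})\right]=E^x\left[\prod_{i=1}^m f_i(X^*_{t_i})\right].$$ -/

import Mathlib

open MeasureTheory ProbabilityTheory Filter Topology Matrix
open scoped NNReal ENNReal BoundedContinuousFunction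

noncomputable section

namespace LevySymm

/-- The symmetric rearrangement of a set: the open ball centered at the origin with the same Lebesgue
measure (the whole space when that measure is infinite), described as the set of the points `x`
for which the ball of radius `‖x‖` has smaller measure than `S`. -/
def symmSet {d : ℕ} (S : Set (EuclideanSpace ℝ (Fin d))) : Set (EuclideanSpace ℝ (Fin d)) :=
  {x | volume (Metric.ball (0 : EuclideanSpace ℝ (Fin d)) ‖x‖) < volume S}

/-- The symmetric decreasing rearrangement, by the layer-cake formula
`f^*(x) = ∫_0^∞ 1_{{f > s}^*}(x) ds`. -/
def rearrangement {d : ℕ} (f : EuclideanSpace ℝ (Fin d) → ℝ≥0∞) :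
    EuclideanSpace ℝ (Fin d) → ℝ≥0∞ :=
  fun x ↦ ∫⁻ s in Set.Ioi (0 : ℝ), (symmSet {y | ENNReal.ofReal s < f y}).indicator 1 x

/-- The matrix `(det A)^{1/d} I_d`. -/
def symmMatrix {d : ℕ} (A : Matrix (Fin d) (Fin d) ℝ) : Matrix (Fin d) (Fin d) ℝ :=
  (A.det ^ (1 / (d : ℝ))) • (1 : Matrix (Fin d) (Fin d) ℝ)

/-- The truncated density `φ_n(y) = φ(y) 1_{|y| > 1/n}`. -/
def truncDensity {d : ℕ} (φ : EuclideanSpace ℝ (Fin d) → ℝ≥0∞) (n : ℕ) :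
    EuclideanSpace ℝ (Fin d) → ℝ≥0∞ :=
  {y | 1 / (n : ℝ) < ‖y‖}.indicator φ

/-- Lévy measures on `ℝ^d`. -/
structure IsLevyMeasure {d : ℕ} (ν : Measure (EuclideanSpace ℝ (Fin d))) : Prop where
  zero : ν {0} = 0
  lintegral_lt_top : ∫⁻ y, ENNReal.ofReal (‖y‖ ^ 2 / (1 + ‖y‖ ^ 2)) ∂ν < ∞

/-- The characteristic exponent
`Ψ(ξ) = -i⟨b,ξ⟩ + ½⟨Aξ,ξ⟩ + ∫ (1 + i⟨ξ,y⟩ 1_{|y|<1} - e^{i⟨ξ,y⟩}) dν(y)`. -/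
def charExponent {d : ℕ} (b : EuclideanSpace ℝ (Fin d)) (A : Matrix (Fin d) (Fin d) ℝ)
    (ν : Measure (EuclideanSpace ℝ (Fin d))) (ξ : EuclideanSpace ℝ (Fin d)) : ℂ :=
  -Complex.I * (inner ℝ b ξ : ℝ) + (1 / 2 : ℂ) * ((ξ.ofLp ⬝ᵥ A *ᵥ ξ.ofLp : ℝ) : ℂ)
    + ∫ y, (1 + Complex.I *
        (((Metric.ball (0 : EuclideanSpace ℝ (Fin d)) 1).indicator (fun y ↦ inner ℝ ξ y) y : ℝ) : ℂ)
        - Complex.exp (Complex.I * (inner ℝ ξ y : ℝ))) ∂ν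

/-- `X` is, under `P`, a Lévy process in `ℝ^d` started at `x`. -/
structure IsLevyProcess {d : ℕ} {Ω : Type*} [MeasurableSpace Ω]
    (X : ℝ≥0 → Ω → EuclideanSpace ℝ (Fin d)) (x : EuclideanSpace ℝ (Fin d))
    (P : Measure Ω) : Prop where
  measurable : ∀ t, Measurable (X t)
  start : ∀ᵐ ω ∂P, X 0 ω = x
  indep : HasIndepIncrements X P
  stationary : ∀ s t, s ≤ t →
    P.map (fun ω ↦ X t ω - X s ω) = P.map (fun ω ↦ X (t - s) ω - X 0 ω)
  stochCont : ∀ s, TendstoInMeasure P X (𝓝 s) (X s)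

/-- `X` is, under `P`, a Lévy process started at `x` with characteristics `(b, A, ν)`:
`E[e^{i⟨ξ,X_t⟩}] = e^{-tΨ(ξ) + i⟨ξ,x⟩}`. -/
structure IsLevyProcessWith {d : ℕ} {Ω : Type*} [MeasurableSpace Ω]
    (X : ℝ≥0 → Ω → EuclideanSpace ℝ (Fin d)) (x b : EuclideanSpace ℝ (Fin d))
    (A : Matrix (Fin d) (Fin d) ℝ) (ν : Measure (EuclideanSpace ℝ (Fin d)))
    (P : Measure Ω) : Prop extends IsLevyProcess X x P where
  charFun_eq : ∀ (t : ℝ≥0) (ξ : EuclideanSpace ℝ (Fin d)),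
    charFun (P.map (X t)) ξ =
      Complex.exp (-((t : ℝ) : ℂ) * charExponent b A ν ξ + Complex.I * (inner ℝ ξ x : ℝ))

/-- `N` is, under `P`, a Poisson process of rate `c` started at `0`. -/
structure IsPoissonProcess {Ω : Type*} [MeasurableSpace Ω] (N : ℝ≥0 → Ω → ℕ) (c : ℝ≥0)
    (P : Measure Ω) : Prop where
  measurable : ∀ t, Measurable (N t)
  start : ∀ᵐ ω ∂P, N 0 ω = 0
  mono : ∀ᵐ ω ∂P, Monotone (fun t ↦ N t ω)
  indep : HasIndepIncrements N P
  hasLaw : ∀ s t, s ≤ t → HasLaw (fun ω ↦ N t ω - N s ω) (poissonMeasure (c * (t - s))) P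

/-- `C` is, under `P`, a compound Poisson process started at `0` with finite Lévy measure `ν`:
`C_t = Y_0 + ... + Y_{N_t - 1}` with `N` a Poisson process of rate `c`, and `Y` an i.i.d. sequence
independent of `N` whose common law `μ` satisfies `ν = c μ` (so `c` is the mass of `ν`, and `μ` is
`ν / c` unless `ν = 0`, in which case `C` vanishes and `μ` plays no role). -/
def IsCompoundPoisson {d : ℕ} {Ω : Type*} [MeasurableSpace Ω]
    (C : ℝ≥0 → Ω → EuclideanSpace ℝ (Fin d)) (ν : Measure (EuclideanSpace ℝ (Fin d)))
    (P : Measure Ω) : Prop :=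
  ∃ (c : ℝ≥0) (μ : Measure (EuclideanSpace ℝ (Fin d))) (N : ℝ≥0 → Ω → ℕ)
    (Y : ℕ → Ω → EuclideanSpace ℝ (Fin d)),
    IsProbabilityMeasure μ ∧ ν = c • μ ∧ IsPoissonProcess N c P ∧
    (∀ k, Measurable (Y k)) ∧ (∀ k, HasLaw (Y k) μ P) ∧ iIndepFun Y P ∧
    IndepFun (fun ω t ↦ N t ω) (fun ω k ↦ Y k ω) P ∧
    ∀ t ω, C t ω = ∑ k ∈ Finset.range (N t ω), Y k ω

/-- `G` is, under `P`, the Gaussian Lévy process started at `x` with drift vector `b` and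
matrix `A`: `G_t` has the normal law with mean `x + t b` and covariance matrix `t A`. -/
structure IsGaussianLevyProcess {d : ℕ} {Ω : Type*} [MeasurableSpace Ω]
    (G : ℝ≥0 → Ω → EuclideanSpace ℝ (Fin d)) (x b : EuclideanSpace ℝ (Fin d))
    (A : Matrix (Fin d) (Fin d) ℝ) (P : Measure Ω) : Prop extends IsLevyProcess G x P where
  hasLaw : ∀ t : ℝ≥0, HasLaw (G t) (multivariateGaussian (x + (t : ℝ) • b) ((t : ℝ) • A)) P

/-- `Z = C + G` with `C` a compound Poisson process started at `0` with Lévy measure `ν`, and `G` an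
independent Gaussian Lévy process started at `x` with drift vector `b` and matrix `A`. -/
def IsPoissonGaussianSum {d : ℕ} {Ω : Type*} [MeasurableSpace Ω]
    (Z : ℝ≥0 → Ω → EuclideanSpace ℝ (Fin d)) (x b : EuclideanSpace ℝ (Fin d))
    (A : Matrix (Fin d) (Fin d) ℝ) (ν : Measure (EuclideanSpace ℝ (Fin d)))
    (P : Measure Ω) : Prop :=
  ∃ C G : ℝ≥0 → Ω → EuclideanSpace ℝ (Fin d),
    IsCompoundPoisson C ν P ∧ IsGaussianLevyProcess G x b A P ∧
    IndepFun (fun ω t ↦ C t ω) (fun ω t ↦ G t ω) P ∧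
    ∀ t ω, Z t ω = C t ω + G t ω

/-- The drift vector `b_n = b - ∫_B y φ_n(y) dy`, where `B` is the unit ball. -/
def truncDrift {d : ℕ} (b : EuclideanSpace ℝ (Fin d)) (φ : EuclideanSpace ℝ (Fin d) → ℝ≥0∞)
    (n : ℕ) : EuclideanSpace ℝ (Fin d) :=
  b - ∫ y in Metric.ball (0 : EuclideanSpace ℝ (Fin d)) 1, y
    ∂(volume.withDensity (truncDensity φ n))

end LevySymm

end

/-!
Both limits are instances of one principle: a process with stationary independent increments and
exponent `ψ` has finite-dimensional distributions determined by `ψ`, and they depend continuously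
on `ψ`. For times `0 ≤ t₁ ≤ ... ≤ tₘ` the vector of increments has characteristic function
`∏ exp (-(tᵢ - tᵢ₋₁) ψ (ξᵢ))` (`HasExponent`), so pointwise convergence of the exponents gives weak
convergence of these vectors by Lévy's continuity theorem, and `∏ fᵢ (X_{tᵢ})` is a bounded
continuous function of the increments (`tendsto_integral_prod_of_tendsto_exponent`).

For a Lévy process the formula for the increments is immediate. For a compound Poisson process one
conditions on the Poisson process: the increments become sums over disjoint blocks of i.i.d. jumps,
and the generating function of the Poisson law finishes the computation
(`IsCompoundPoisson.hasExponent`). Adding the independent Gaussian part, the approximating process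
has exponent `charExponent a A ν`, where the drift `a` exceeds the Gaussian drift by `∫_B y dν`
(`IsPoissonGaussianSum.hasExponent`). This explains the drift `truncDrift`; for the rearranged
density, which is even, the correction vanishes.

Convergence of the exponents is dominated convergence: the integrand is bounded by a multiple of
`|y|² / (1 + |y|²)`, and the densities increase to their limit (`tendsto_charExponent`). For the
rearranged densities this uses two facts. Rearrangement preserves increasing limits, because the
measures of the superlevel sets do (`tendsto_rearrangement`); and `φ^*` is again a Lévy density,
because rearranging a set decreases the integral of a radially nondecreasing weight
(`IsLevyMeasure.rearrangement`).
-/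

namespace LevySymm

/-! ### Joint characteristic functions of increments -/

section Increments

variable {d : ℕ} {Ω : Type*} [MeasurableSpace Ω]

/-- The process `X` has independent and stationary increments with exponent `ψ`: along every
finite monotone sequence of times, the joint characteristic function of the increments is
`∏ exp (-(Δt) ψ)`. The increments are collected into one vector of an `L²` product, so that
the statement concerns the characteristic function of one finite-dimensional law. -/
def HasExponent (X : ℝ≥0 → Ω → EuclideanSpace ℝ (Fin d)) (ψ : EuclideanSpace ℝ (Fin d) → ℂ)
    (P : Measure Ω) : Prop :=
  ∀ (n : ℕ) (τ : Fin (n + 1) → ℝ≥0), Monotone τ →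
    ∀ ξ : PiLp 2 (fun _ : Fin n ↦ EuclideanSpace ℝ (Fin d)),
      charFun (P.map fun ω ↦ WithLp.toLp 2 fun i : Fin n ↦ X (τ i.succ) ω - X (τ i.castSucc) ω) ξ =
        ∏ i : Fin n, Complex.exp (-(((τ i.succ - τ i.castSucc : ℝ≥0) : ℝ) : ℂ) * ψ (ξ i))

/-- Independence of the increments and the one-time characteristic functions determine the joint
characteristic functions of the increments. -/
lemma IsLevyProcess.hasExponent {P : Measure Ω} [IsProbabilityMeasure P]
    {X : ℝ≥0 → Ω → EuclideanSpace ℝ (Fin d)} {x : EuclideanSpace ℝ (Fin d)}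
    (hX : IsLevyProcess X x P) {ψ : EuclideanSpace ℝ (Fin d) → ℂ}
    (hψ : ∀ (t : ℝ≥0) (ξ : EuclideanSpace ℝ (Fin d)), charFun (P.map (X t)) ξ =
      Complex.exp (-((t : ℝ) : ℂ) * ψ ξ + Complex.I * (inner ℝ ξ x : ℝ))) :
    HasExponent X ψ P := by
  intro n τ hτ ξ
  have hm : ∀ i : Fin n, Measurable fun ω ↦ X (τ i.succ) ω - X (τ i.castSucc) ω :=
    fun i ↦ (hX.measurable _).sub (hX.measurable _)
  rw [(iIndepFun_iff_charFun_pi fun i ↦ (hm i).aemeasurable).1 (hX.indep n τ hτ) ξ]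
  refine Finset.prod_congr rfl fun i _ ↦ ?_
  rw [hX.stationary _ _ (hτ i.castSucc_lt_succ.le)]
  set t := τ i.succ - τ i.castSucc
  have h0 : (fun ω ↦ X t ω - X 0 ω) =ᵐ[P] fun ω ↦ X t ω + -x := by
    filter_upwards [hX.start] with ω hω
    rw [hω, sub_eq_add_neg]
  rw [Measure.map_congr h0]
  have : (P.map fun ω ↦ X t ω + -x) = (P.map (X t)).map (· + -x) := by
    rw [Measure.map_map (by fun_prop) (hX.measurable t)]; rfl
  rw [this, charFun_map_add_const, hψ, ← Complex.exp_add]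
  congr 1
  rw [inner_neg_left, real_inner_comm]
  push_cast
  ring

/-- For a fixed monotone sequence of counts, the block sums of an i.i.d. sequence have as joint
characteristic function the product of the corresponding powers. -/
lemma integral_exp_blockSum {P : Measure Ω} [IsProbabilityMeasure P]
    {μ : Measure (EuclideanSpace ℝ (Fin d))}
    {Y : ℕ → Ω → EuclideanSpace ℝ (Fin d)} (hYm : ∀ k, Measurable (Y k))
    (hY : ∀ k, HasLaw (Y k) μ P) (hYi : iIndepFun Y P) {n : ℕ} {η : Fin (n + 1) → ℕ}
    (hη : Monotone η) (ξ : Fin n → EuclideanSpace ℝ (Fin d)) :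
    ∫ ω, Complex.exp (((∑ i : Fin n, ∑ k ∈ Finset.Ico (η i.castSucc) (η i.succ),
        inner ℝ (Y k ω) (ξ i) : ℝ) : ℂ) * Complex.I) ∂P =
      ∏ i : Fin n, charFun μ (ξ i) ^ (η i.succ - η i.castSucc) := by
  -- The blocks are disjoint, so the pairs (block, index in it) enumerate distinct jumps.
  let g : (Σ i : Fin n, Finset.Ico (η i.castSucc) (η i.succ)) → ℕ := fun p ↦ p.2.1
  have hg : Function.Injective g := by
    rintro ⟨i, k, hk⟩ ⟨j, l, hl⟩ (rfl : k = l)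
    rw [Finset.mem_Ico] at hk hl
    obtain h | rfl | h := lt_trichotomy i j
    · have := hη (Fin.succ_le_castSucc_iff.2 h)
      omega
    · rfl
    · have := hη (Fin.succ_le_castSucc_iff.2 h)
      omega
  have h1 := (hYi.precomp hg).integral_fun_prod_comp (𝕜 := ℂ)
    (f := fun p y ↦ Complex.exp (((inner ℝ y (ξ p.1) : ℝ) : ℂ) * Complex.I))
    (fun p ↦ (hYm _).aemeasurable) (fun p ↦ by fun_prop)
  have h2 : ∀ p : (Σ i : Fin n, Finset.Ico (η i.castSucc) (η i.succ)),
      ∫ ω, Complex.exp (((inner ℝ (Y (g p) ω) (ξ p.1) : ℝ) : ℂ) * Complex.I) ∂P =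
        charFun μ (ξ p.1) := by
    intro p
    rw [← (hY (g p)).map_eq, charFun_apply, integral_map (hYm _).aemeasurable (by fun_prop)]
  simp only [h2, Fintype.prod_sigma, Finset.prod_const, Finset.card_univ, Fintype.card_coe,
    Nat.card_Ico] at h1
  rw [← h1]
  congr with ω
  push_cast
  rw [Finset.sum_mul, Complex.exp_sum]
  congr with i
  rw [Finset.sum_mul, Complex.exp_sum, ← Finset.prod_coe_sort]

/-- The probability generating function of the Poisson distribution. -/
lemma integral_pow_poissonMeasure (r : ℝ≥0) (z : ℂ) :
    ∫ k, z ^ k ∂(poissonMeasure r) = Complex.exp ((r : ℝ) * (z - 1)) := by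
  rw [integral_poissonMeasure]
  calc ∑' k : ℕ, (Real.exp (-r) * r ^ k / (k.factorial : ℝ)) • z ^ k
      = ∑' k : ℕ, (Real.exp (-r) : ℂ) * (((r : ℝ) * z) ^ k / (k.factorial : ℂ)) := by
        congr with k
        rw [Complex.real_smul]
        push_cast
        rw [mul_pow]
        ring
    _ = Complex.exp ((r : ℝ) * (z - 1)) := by
        rw [tsum_mul_left, (NormedSpace.expSeries_div_hasSum_exp ((r : ℝ) * z : ℂ)).tsum_eq,
          ← Complex.exp_eq_exp_ℂ, Complex.ofReal_exp, ← Complex.exp_add]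
        push_cast
        ring_nf

lemma IsCompoundPoisson.measurable {P : Measure Ω} {ν : Measure (EuclideanSpace ℝ (Fin d))}
    {C : ℝ≥0 → Ω → EuclideanSpace ℝ (Fin d)} (hC : IsCompoundPoisson C ν P) (t : ℝ≥0) :
    Measurable (C t) := by
  obtain ⟨c, μ, N, Y, hμ, hν, hN, hYm, hY, hYi, hNY, hCt⟩ := hC
  have h : Measurable fun p : ℕ × Ω ↦ ∑ k ∈ Finset.range p.1, Y k p.2 :=
    measurable_from_prod_countable_right fun n ↦ by
      simp only
      fun_prop
  have h' := h.comp ((hN.measurable t).prodMk measurable_id)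
  rwa [show C t = _ from funext fun ω ↦ hCt t ω]

lemma IsCompoundPoisson.start {P : Measure Ω} {ν : Measure (EuclideanSpace ℝ (Fin d))}
    {C : ℝ≥0 → Ω → EuclideanSpace ℝ (Fin d)} (hC : IsCompoundPoisson C ν P) :
    ∀ᵐ ω ∂P, C 0 ω = 0 := by
  obtain ⟨c, μ, N, Y, hμ, hν, hN, hYm, hY, hYi, hNY, hCt⟩ := hC
  filter_upwards [hN.start] with ω hω
  simp [hCt, hω]

lemma IsCompoundPoisson.isFiniteMeasure {P : Measure Ω} {ν : Measure (EuclideanSpace ℝ (Fin d))}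
    {C : ℝ≥0 → Ω → EuclideanSpace ℝ (Fin d)} (hC : IsCompoundPoisson C ν P) :
    IsFiniteMeasure ν := by
  obtain ⟨c, μ, N, Y, hμ, rfl, -⟩ := hC
  infer_instance

/-- Conditionally on the Poisson process, the increments of a compound Poisson process are sums
over disjoint blocks of the i.i.d. jumps; averaging over the Poisson increments gives the
exponent. -/
lemma IsCompoundPoisson.hasExponent {P : Measure Ω} [IsProbabilityMeasure P]
    {ν : Measure (EuclideanSpace ℝ (Fin d))}
    {C : ℝ≥0 → Ω → EuclideanSpace ℝ (Fin d)} (hC : IsCompoundPoisson C ν P) :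
    HasExponent C (fun ξ ↦ ∫ y, (1 - Complex.exp (Complex.I * (inner ℝ ξ y : ℝ))) ∂ν) P := by
  have hCm := hC.measurable
  obtain ⟨c, μ, N, Y, hμ, hν, hN, hYm, hY, hYi, hNY, hCt⟩ := hC
  intro n τ hτ ξ
  let F : (Fin (n + 1) → ℕ) → (ℕ → EuclideanSpace ℝ (Fin d)) → ℂ := fun η y ↦
    Complex.exp (((∑ i : Fin n, ∑ k ∈ Finset.Ico (η i.castSucc) (η i.succ),
        inner ℝ (y k) (ξ i) : ℝ) : ℂ) * Complex.I)
  have hF : Measurable (Function.uncurry F) :=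
    measurable_from_prod_countable_right fun η ↦ by
      simp only [Function.uncurry, F]
      fun_prop
  have hmono : ∀ᵐ ω ∂P, Monotone fun i ↦ N (τ i) ω := by
    filter_upwards [hN.mono] with ω hω
    exact hω.comp hτ
  have hNτ : Measurable fun ω i ↦ N (τ i) ω := measurable_pi_lambda _ fun i ↦ hN.measurable _
  have hYm' : Measurable fun ω k ↦ Y k ω := measurable_pi_lambda _ hYm
  have hind : IndepFun (fun ω i ↦ N (τ i) ω) (fun ω k ↦ Y k ω) P := by
    have : Measurable fun (f : ℝ≥0 → ℕ) i ↦ f (τ i) := by fun_prop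
    exact hNY.comp this measurable_id
  have h1 : charFun (P.map fun ω ↦ WithLp.toLp 2
      fun i : Fin n ↦ C (τ i.succ) ω - C (τ i.castSucc) ω) ξ =
      ∫ ω, F (fun i ↦ N (τ i) ω) (fun k ↦ Y k ω) ∂P := by
    rw [charFun_apply, integral_map (by fun_prop) (by fun_prop)]
    refine integral_congr_ae ?_
    filter_upwards [hmono] with ω hω
    simp only [F]
    rw [PiLp.inner_apply]
    congr 3
    refine Finset.sum_congr rfl fun i _ ↦ ?_
    simp only
    rw [hCt, hCt, ← Finset.sum_Ico_eq_sub _ (hω i.castSucc_lt_succ.le), sum_inner]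
  -- Integrate first over the jumps, with the counts frozen.
  have h2 : ∫ ω, F (fun i ↦ N (τ i) ω) (fun k ↦ Y k ω) ∂P =
      ∫ ω, (∫ ω', F (fun i ↦ N (τ i) ω) (fun k ↦ Y k ω') ∂P) ∂P := by
    have hI : Integrable (Function.uncurry F)
        ((P.map fun ω i ↦ N (τ i) ω).prod (P.map fun ω k ↦ Y k ω)) := by
      have := Measure.isProbabilityMeasure_map (μ := P) hNτ.aemeasurable
      have := Measure.isProbabilityMeasure_map (μ := P) hYm'.aemeasurable
      refine Integrable.of_bound hF.aestronglyMeasurable 1 (ae_of_all _ fun p ↦ ?_)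
      exact (Complex.norm_exp_ofReal_mul_I _).le
    have e1 := integral_map (μ := P) (hNτ.prodMk hYm').aemeasurable
      (f := Function.uncurry F) hF.aestronglyMeasurable
    rw [(indepFun_iff_map_prod_eq_prod_map_map hNτ.aemeasurable hYm'.aemeasurable).1 hind,
      integral_prod _ hI, integral_map hNτ.aemeasurable
        hF.stronglyMeasurable.integral_prod_right'.aestronglyMeasurable] at e1
    refine e1.symm.trans (integral_congr_ae (ae_of_all _ fun ω ↦ ?_))
    exact integral_map hYm'.aemeasurable (hF.comp measurable_prodMk_left).aestronglyMeasurable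
  have h3 : ∫ ω, (∫ ω', F (fun i ↦ N (τ i) ω) (fun k ↦ Y k ω') ∂P) ∂P =
      ∫ ω, ∏ i : Fin n, charFun μ (ξ i) ^ (N (τ i.succ) ω - N (τ i.castSucc) ω) ∂P := by
    refine integral_congr_ae ?_
    filter_upwards [hmono] with ω hω
    exact integral_exp_blockSum hYm hY hYi hω ξ
  have h4 := (hN.indep n τ hτ).integral_fun_prod_comp (𝕜 := ℂ)
    (f := fun i k ↦ charFun μ (ξ i) ^ k)
    (fun i ↦ (hN.measurable _).sub (hN.measurable _) |>.aemeasurable)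
    (fun i ↦ Measurable.of_discrete.aestronglyMeasurable)
  rw [h1, h2, h3, h4]
  refine Finset.prod_congr rfl fun i _ ↦ ?_
  have hlaw := hN.hasLaw _ _ (hτ i.castSucc_lt_succ.le)
  rw [← integral_map (f := fun k : ℕ ↦ charFun μ (ξ i) ^ k) hlaw.aemeasurable
    Measurable.of_discrete.aestronglyMeasurable, hlaw.map_eq, integral_pow_poissonMeasure, hν]
  congr 1
  have hint : Integrable (fun y ↦ Complex.exp (Complex.I * (inner ℝ (ξ i) y : ℝ))) μ := by
    refine Integrable.of_bound (by fun_prop) 1 (ae_of_all _ fun y ↦ ?_)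
    rw [mul_comm, Complex.norm_exp_ofReal_mul_I]
  simp only
  rw [integral_smul_nnreal_measure, integral_sub (integrable_const _) hint, charFun_apply]
  simp only [integral_const, probReal_univ, one_smul, mul_comm Complex.I, real_inner_comm (ξ i)]
  rw [NNReal.smul_def, Complex.real_smul]
  push_cast
  ring

lemma HasExponent.add {P : Measure Ω} [IsProbabilityMeasure P]
    {C G : ℝ≥0 → Ω → EuclideanSpace ℝ (Fin d)} {ψ χ : EuclideanSpace ℝ (Fin d) → ℂ}
    (hC : HasExponent C ψ P) (hG : HasExponent G χ P) (hCm : ∀ t, Measurable (C t))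
    (hGm : ∀ t, Measurable (G t))
    (h : IndepFun (fun ω t ↦ C t ω) (fun ω t ↦ G t ω) P) :
    HasExponent (fun t ω ↦ C t ω + G t ω) (fun ξ ↦ ψ ξ + χ ξ) P := by
  intro n τ hτ ξ
  have hL : Measurable fun (f : ℝ≥0 → EuclideanSpace ℝ (Fin d)) ↦
      WithLp.toLp 2 fun i : Fin n ↦ f (τ i.succ) - f (τ i.castSucc) := by fun_prop
  have e := (h.comp hL hL).charFun_map_fun_add_eq_mul
    (hL.comp (measurable_pi_lambda _ hCm)).aemeasurable
    (hL.comp (measurable_pi_lambda _ hGm)).aemeasurable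
  have e' : (fun ω ↦ WithLp.toLp 2 fun i : Fin n ↦
      (C (τ i.succ) ω + G (τ i.succ) ω) - (C (τ i.castSucc) ω + G (τ i.castSucc) ω)) =
      fun ω ↦ (WithLp.toLp 2 fun i : Fin n ↦ C (τ i.succ) ω - C (τ i.castSucc) ω) +
        WithLp.toLp 2 fun i : Fin n ↦ G (τ i.succ) ω - G (τ i.castSucc) ω := by
    ext ω i : 2
    simp
    abel
  rw [e']
  refine (congrFun e ξ).trans ?_
  rw [Pi.mul_apply]
  refine (congrArg₂ (· * ·) (hC n τ hτ ξ) (hG n τ hτ ξ)).trans ?_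
  simp only
  rw [← Finset.prod_mul_distrib]
  refine Finset.prod_congr rfl fun i _ ↦ ?_
  rw [← Complex.exp_add]
  ring_nf

end Increments

/-! ### Convergence of finite-dimensional distributions -/

section Convergence

variable {d m : ℕ}

lemma monotone_cons_zero {t : Fin m → ℝ≥0} (ht : Monotone t) :
    Monotone (Fin.cons 0 t : Fin (m + 1) → ℝ≥0) := by
  refine Fin.cases (fun j _ ↦ ?_) (fun i ↦ Fin.cases (fun hi ↦ ?_) fun j hij ↦ ?_)
  · simp
  · simp at hi
  · simpa using ht (Fin.succ_le_succ_iff.1 hij)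

/-- A product of functions of the positions `g (t i)` of a path started at `x` is a bounded
continuous function of the vector of increments. -/
lemma exists_boundedContinuous_increments (x : EuclideanSpace ℝ (Fin d))
    (f : Fin m → (EuclideanSpace ℝ (Fin d) →ᵇ ℝ)) (t : Fin m → ℝ≥0) :
    ∃ H : PiLp 2 (fun _ : Fin m ↦ EuclideanSpace ℝ (Fin d)) →ᵇ ℝ,
      ∀ g : ℝ≥0 → EuclideanSpace ℝ (Fin d), g 0 = x → ∏ i, f i (g (t i)) =
        H (WithLp.toLp 2 fun i ↦ g ((Fin.cons 0 t : Fin (m + 1) → ℝ≥0) i.succ) -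
          g ((Fin.cons 0 t : Fin (m + 1) → ℝ≥0) i.castSucc)) := by
  let H : PiLp 2 (fun _ : Fin m ↦ EuclideanSpace ℝ (Fin d)) →ᵇ ℝ :=
    ∏ i, (f i).compContinuous ⟨fun v ↦ x + ∑ j ∈ Finset.Iic i, v j, by fun_prop⟩
  refine ⟨H, fun g hg ↦ ?_⟩
  simp only [H, BoundedContinuousFunction.coe_prod, Finset.prod_apply]
  refine Finset.prod_congr rfl fun i _ ↦ ?_
  simp only [BoundedContinuousFunction.compContinuous_apply, ContinuousMap.coe_mk]
  rw [Fin.sum_Iic_sub i (fun k ↦ g ((Fin.cons 0 t : Fin (m + 1) → ℝ≥0) k))]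
  simp [hg]

lemma measurable_increments {Ω : Type*} [MeasurableSpace Ω]
    {X : ℝ≥0 → Ω → EuclideanSpace ℝ (Fin d)} (hX : ∀ t, Measurable (X t))
    (τ : Fin (m + 1) → ℝ≥0) : Measurable fun ω ↦ (WithLp.toLp 2 fun i : Fin m ↦
      X (τ i.succ) ω - X (τ i.castSucc) ω :
        PiLp 2 (fun _ : Fin m ↦ EuclideanSpace ℝ (Fin d))) := by
  fun_prop

lemma integral_comp_increments {Ω : Type*} [MeasurableSpace Ω] {P : Measure Ω}
    {x : EuclideanSpace ℝ (Fin d)} {X : ℝ≥0 → Ω → EuclideanSpace ℝ (Fin d)}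
    (hX : ∀ t, Measurable (X t)) (hX0 : ∀ᵐ ω ∂P, X 0 ω = x) (τ : Fin (m + 1) → ℝ≥0)
    (H : PiLp 2 (fun _ : Fin m ↦ EuclideanSpace ℝ (Fin d)) →ᵇ ℝ)
    {F : (ℝ≥0 → EuclideanSpace ℝ (Fin d)) → ℝ}
    (hH : ∀ g : ℝ≥0 → EuclideanSpace ℝ (Fin d), g 0 = x →
      F g = H (WithLp.toLp 2 fun i ↦ g (τ i.succ) - g (τ i.castSucc))) :
    ∫ ω, F (fun t ↦ X t ω) ∂P = ∫ v, H v ∂(P.map fun ω ↦ WithLp.toLp 2 fun i : Fin m ↦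
      X (τ i.succ) ω - X (τ i.castSucc) ω) := by
  rw [integral_map (measurable_increments hX τ).aemeasurable
    H.continuous.measurable.aestronglyMeasurable]
  refine integral_congr_ae ?_
  filter_upwards [hX0] with ω hω
  exact hH _ hω

/-- Convergence of the exponents forces convergence of the finite-dimensional distributions, by
Lévy's continuity theorem for the vector of increments. -/
lemma tendsto_integral_prod_of_tendsto_exponent {Ω : Type*} [MeasurableSpace Ω] {P : Measure Ω}
    [IsProbabilityMeasure P] {Γ : ℕ → Type*} [∀ n, MeasurableSpace (Γ n)] {Q : ∀ n, Measure (Γ n)}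
    [∀ n, IsProbabilityMeasure (Q n)] {x : EuclideanSpace ℝ (Fin d)}
    {X : ℝ≥0 → Ω → EuclideanSpace ℝ (Fin d)} {Z : ∀ n, ℝ≥0 → Γ n → EuclideanSpace ℝ (Fin d)}
    {ψ : EuclideanSpace ℝ (Fin d) → ℂ} {χ : ℕ → EuclideanSpace ℝ (Fin d) → ℂ}
    (hXm : ∀ t, Measurable (X t)) (hX0 : ∀ᵐ ω ∂P, X 0 ω = x) (hX : HasExponent X ψ P)
    (hZm : ∀ n t, Measurable (Z n t)) (hZ0 : ∀ n, ∀ᵐ ω ∂(Q n), Z n 0 ω = x)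
    (hZ : ∀ n, HasExponent (Z n) (χ n) (Q n))
    (h : ∀ ξ, Tendsto (fun n ↦ χ n ξ) atTop (𝓝 (ψ ξ)))
    (f : Fin m → (EuclideanSpace ℝ (Fin d) →ᵇ ℝ)) {t : Fin m → ℝ≥0} (ht : Monotone t) :
    Tendsto (fun n ↦ ∫ ω, ∏ i, f i (Z n (t i) ω) ∂(Q n)) atTop
      (𝓝 (∫ ω, ∏ i, f i (X (t i) ω) ∂P)) := by
  have hτ := monotone_cons_zero ht
  obtain ⟨H, hH⟩ := exists_boundedContinuous_increments x f t
  set τ : Fin (m + 1) → ℝ≥0 := Fin.cons 0 t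
  have eX := integral_comp_increments hXm hX0 τ H
    (F := fun g ↦ ∏ i, f i (g (t i))) hH
  have eZ n := integral_comp_increments (hZm n) (hZ0 n) τ H
    (F := fun g ↦ ∏ i, f i (g (t i))) hH
  simp only [eX, eZ]
  let μ : ProbabilityMeasure (PiLp 2 fun _ : Fin m ↦ EuclideanSpace ℝ (Fin d)) :=
    ⟨_, Measure.isProbabilityMeasure_map (μ := P) (measurable_increments hXm τ).aemeasurable⟩
  let μn : ℕ → ProbabilityMeasure (PiLp 2 fun _ : Fin m ↦ EuclideanSpace ℝ (Fin d)) := fun n ↦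
    ⟨_, Measure.isProbabilityMeasure_map (μ := Q n) (measurable_increments (hZm n) τ).aemeasurable⟩
  have hμ : Tendsto μn atTop (𝓝 μ) := by
    refine ProbabilityMeasure.tendsto_of_tendsto_charFun fun ξ ↦ ?_
    change Tendsto (fun n ↦ charFun ((Q n).map _) ξ) _ (𝓝 (charFun (P.map _) ξ))
    rw [hX m τ hτ ξ]
    simp only [hZ _ m τ hτ ξ]
    exact tendsto_finsetProd _ fun i _ ↦
      (Complex.continuous_exp.tendsto _).comp ((h (ξ i)).const_mul _)
  exact ProbabilityMeasure.tendsto_iff_forall_integral_tendsto.1 hμ H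

end Convergence

/-! ### Symmetric decreasing rearrangement -/

section Rearrangement

variable {d : ℕ}

lemma measurable_volume_ball_norm :
    Measurable fun x : EuclideanSpace ℝ (Fin d) ↦
      volume (Metric.ball (0 : EuclideanSpace ℝ (Fin d)) ‖x‖) := by
  have h : Monotone fun r : ℝ ↦ volume (Metric.ball (0 : EuclideanSpace ℝ (Fin d)) r) :=
    fun r s hrs ↦ measure_mono (Metric.ball_subset_ball hrs)
  exact h.measurable.comp measurable_norm

lemma measurable_volume_superlevel (f : EuclideanSpace ℝ (Fin d) → ℝ≥0∞) :
    Measurable fun s : ℝ ↦ volume {y | ENNReal.ofReal s < f y} := by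
  have h : Antitone fun s : ℝ ↦ volume {y | ENNReal.ofReal s < f y} :=
    fun r s hrs ↦ measure_mono fun y (hy : _ < _) ↦ (ENNReal.ofReal_le_ofReal hrs).trans_lt hy
  exact h.measurable

lemma measurable_indicator_symmSet (f : EuclideanSpace ℝ (Fin d) → ℝ≥0∞) :
    Measurable fun p : EuclideanSpace ℝ (Fin d) × ℝ ↦
      (symmSet {y | ENNReal.ofReal p.2 < f y}).indicator (1 : EuclideanSpace ℝ (Fin d) → ℝ≥0∞) p.1 := by
  have h : MeasurableSet {p : EuclideanSpace ℝ (Fin d) × ℝ |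
      volume (Metric.ball (0 : EuclideanSpace ℝ (Fin d)) ‖p.1‖) <
        volume {y | ENNReal.ofReal p.2 < f y}} :=
    measurableSet_lt (measurable_volume_ball_norm.comp measurable_fst)
      ((measurable_volume_superlevel f).comp measurable_snd)
  exact measurable_one.indicator h

lemma measurable_rearrangement (f : EuclideanSpace ℝ (Fin d) → ℝ≥0∞) :
    Measurable (rearrangement f) :=
  (measurable_indicator_symmSet f).lintegral_prod_right'

lemma symmSet_mono {S T : Set (EuclideanSpace ℝ (Fin d))} (h : S ⊆ T) : symmSet S ⊆ symmSet T :=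
  fun _ hx ↦ lt_of_lt_of_le hx (measure_mono h)

lemma rearrangement_mono {f g : EuclideanSpace ℝ (Fin d) → ℝ≥0∞} (h : f ≤ g) :
    rearrangement f ≤ rearrangement g := by
  intro x
  refine lintegral_mono fun s ↦ ?_
  exact Set.indicator_le_indicator_of_subset
    (symmSet_mono fun y (hy : _ < _) ↦ hy.trans_le (h y)) (fun _ ↦ zero_le_one) x

lemma rearrangement_neg (f : EuclideanSpace ℝ (Fin d) → ℝ≥0∞) (x : EuclideanSpace ℝ (Fin d)) :
    rearrangement f (-x) = rearrangement f x := by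
  simp [rearrangement, symmSet, Set.indicator_apply]

/-- Rearrangement is continuous along increasing sequences. -/
lemma tendsto_rearrangement {f : ℕ → EuclideanSpace ℝ (Fin d) → ℝ≥0∞}
    {g : EuclideanSpace ℝ (Fin d) → ℝ≥0∞} (hf : Monotone f) (hfg : ∀ n, f n ≤ g)
    (h : ∀ᵐ y, Tendsto (fun n ↦ f n y) atTop (𝓝 (g y)))
    (x : EuclideanSpace ℝ (Fin d)) :
    Tendsto (fun n ↦ rearrangement (f n) x) atTop (𝓝 (rearrangement g x)) := by
  have hm : ∀ s, Monotone fun n ↦ {y | ENNReal.ofReal s < f n y} :=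
    fun s k l hkl y (hy : _ < _) ↦ hy.trans_le (hf hkl y)
  have hvol : ∀ s : ℝ, Tendsto (fun n ↦ volume {y | ENNReal.ofReal s < f n y}) atTop
      (𝓝 (volume {y | ENNReal.ofReal s < g y})) := by
    intro s
    have e : volume {y | ENNReal.ofReal s < g y} =
        volume (⋃ n, {y | ENNReal.ofReal s < f n y}) := by
      refine measure_congr ?_
      filter_upwards [h] with y hy
      refine propext ⟨fun hs : _ < _ ↦ ?_, fun hs ↦ ?_⟩
      · exact Set.mem_iUnion.2 (hy.eventually (lt_mem_nhds hs)).exists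
      · obtain ⟨n, hn⟩ := Set.mem_iUnion.1 hs
        exact lt_of_lt_of_le hn (hfg n y)
    rw [e]
    exact tendsto_measure_iUnion_atTop (hm s)
  refine lintegral_tendsto_of_tendsto_of_monotone
    (fun n ↦ ((measurable_indicator_symmSet (f n)).comp measurable_prodMk_left).aemeasurable)
    (ae_of_all _ fun s k l hkl ↦ ?_) (ae_of_all _ fun s ↦ ?_)
  · exact Set.indicator_le_indicator_of_subset (symmSet_mono (hm s hkl)) (fun _ ↦ zero_le_one) x
  · by_cases hx : x ∈ symmSet {y | ENNReal.ofReal s < g y}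
    · refine tendsto_const_nhds.congr' ?_
      filter_upwards [(hvol s).eventually (lt_mem_nhds hx)] with n hn
      rw [Set.indicator_of_mem hx, Set.indicator_of_mem (show x ∈ symmSet _ from hn)]
    · refine tendsto_const_nhds.congr fun n ↦ ?_
      rw [Set.indicator_of_notMem hx, Set.indicator_of_notMem]
      exact fun hn ↦ hx (symmSet_mono (fun y (hy : _ < _) ↦ hy.trans_le (hfg n y)) hn)

/-- A set of finite measure is rearranged into an open ball of the same measure. -/
lemma exists_symmSet_eq_ball (hd : 1 ≤ d) {S : Set (EuclideanSpace ℝ (Fin d))}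
    (hS : volume S ≠ ∞) : ∃ R : ℝ, 0 ≤ R ∧ symmSet S = Metric.ball 0 R ∧
      volume (Metric.ball (0 : EuclideanSpace ℝ (Fin d)) R) = volume S := by
  have : Nonempty (Fin d) := ⟨⟨0, hd⟩⟩
  set c := volume (Metric.ball (0 : EuclideanSpace ℝ (Fin d)) 1) with hc
  have hc0 : c ≠ 0 := (Metric.measure_ball_pos _ _ one_pos).ne'
  have hct : c ≠ ∞ := measure_ball_lt_top.ne
  have hball : ∀ r : ℝ, 0 ≤ r →
      volume (Metric.ball (0 : EuclideanSpace ℝ (Fin d)) r) = ENNReal.ofReal (r ^ d) * c := by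
    intro r hr
    simpa using Measure.addHaar_ball (volume : Measure (EuclideanSpace ℝ (Fin d))) 0 hr
  set q := ((volume S) / c).toReal
  have hq : 0 ≤ q := ENNReal.toReal_nonneg
  have hR0 : 0 ≤ q ^ (1 / (d : ℝ)) := Real.rpow_nonneg hq _
  have hR : (q ^ (1 / (d : ℝ))) ^ d = q := by
    rw [one_div]
    exact Real.rpow_inv_natCast_pow hq (by omega)
  have hvol : volume (Metric.ball (0 : EuclideanSpace ℝ (Fin d)) (q ^ (1 / (d : ℝ)))) =
      volume S := by
    rw [hball _ hR0, hR, ENNReal.ofReal_toReal (ENNReal.div_ne_top hS hc0),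
      ENNReal.div_mul_cancel hc0 hct]
  refine ⟨_, hR0, ?_, hvol⟩
  ext x
  rw [mem_ball_zero_iff, ← pow_lt_pow_iff_left₀ (norm_nonneg x) hR0 (by omega : d ≠ 0)]
  change volume (Metric.ball _ ‖x‖) < volume S ↔ _
  rw [← hvol, hball _ (norm_nonneg x), hball _ hR0, ENNReal.mul_lt_mul_iff_left hc0 hct,
    ENNReal.ofReal_lt_ofReal_iff']
  constructor
  · exact fun h ↦ h.1
  · exact fun h ↦ ⟨h, (pow_nonneg (norm_nonneg x) d).trans_lt h⟩

lemma ofReal_sq_div_one_add_sq_mono {r s : ℝ} (hr : 0 ≤ r) (hrs : r ≤ s) :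
    r ^ 2 / (1 + r ^ 2) ≤ s ^ 2 / (1 + s ^ 2) := by
  have h : r ^ 2 ≤ s ^ 2 := by gcongr
  rw [div_le_div_iff₀ (by positivity) (by positivity)]
  nlinarith

/-- A radially nondecreasing weight has a smaller integral over the rearranged set: the part of
the ball that is not covered by `S` lies inside the radius, the part of `S` outside the ball lies
beyond it, and the two have the same measure. -/
lemma setLIntegral_symmSet_le (hd : 1 ≤ d) {S : Set (EuclideanSpace ℝ (Fin d))}
    (hS : MeasurableSet S) :
    ∫⁻ y in symmSet S, ENNReal.ofReal (‖y‖ ^ 2 / (1 + ‖y‖ ^ 2)) ≤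
      ∫⁻ y in S, ENNReal.ofReal (‖y‖ ^ 2 / (1 + ‖y‖ ^ 2)) := by
  set w : EuclideanSpace ℝ (Fin d) → ℝ≥0∞ := fun y ↦ ENNReal.ofReal (‖y‖ ^ 2 / (1 + ‖y‖ ^ 2))
  -- When `S` has infinite measure its rearrangement is the whole space, but the weight is at least
  -- `1 / 2` outside the unit ball, so that the right-hand side is infinite too.
  by_cases hfin : volume S = ∞
  · suffices ∫⁻ y in S, w y = ∞ by rw [this]; exact le_top
    have h1 : volume (S \ Metric.ball 0 1) = ∞ := by
      by_contra h
      have := measure_le_inter_add_sdiff volume S (Metric.ball 0 1)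
      rw [hfin, top_le_iff, ENNReal.add_eq_top] at this
      rcases this with h' | h'
      · exact ((measure_mono Set.inter_subset_right).trans_lt
          (measure_ball_lt_top (x := 0) (r := 1))).ne h'
      · exact h h'
    refine top_le_iff.1 ?_
    calc ∞ = ENNReal.ofReal (1 / 2) * volume (S \ Metric.ball 0 1) := by
          rw [h1, ENNReal.mul_top (by simp)]
      _ = ∫⁻ y in S \ Metric.ball 0 1, ENNReal.ofReal (1 / 2) := by
          rw [setLIntegral_const]
      _ ≤ ∫⁻ y in S \ Metric.ball 0 1, w y := by
          refine setLIntegral_mono' (hS.diff measurableSet_ball) fun y hy ↦ ?_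
          have : 1 ≤ ‖y‖ := by simpa using hy.2
          refine ENNReal.ofReal_le_ofReal ?_
          have := ofReal_sq_div_one_add_sq_mono zero_le_one this
          norm_num at this ⊢
          exact this
      _ ≤ ∫⁻ y in S, w y := lintegral_mono_set Set.sdiff_subset
  obtain ⟨R, hR0, hSR, hvol⟩ := exists_symmSet_eq_ball hd hfin
  set T : Set (EuclideanSpace ℝ (Fin d)) := Metric.ball 0 R
  have hT : MeasurableSet T := measurableSet_ball
  have hdiff : volume (T \ S) = volume (S \ T) := by
    have h1 := measure_inter_add_sdiff (μ := volume) T hS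
    have h2 := measure_inter_add_sdiff (μ := volume) S hT
    rw [Set.inter_comm] at h2
    have h3 : volume (T ∩ S) ≠ ∞ := measure_ne_top_of_subset Set.inter_subset_right hfin
    exact (ENNReal.add_right_inj h3).1 (h1.trans (hvol.trans h2.symm))
  rw [hSR, ← lintegral_inter_add_sdiff w T hS, ← lintegral_inter_add_sdiff w S hT, Set.inter_comm]
  gcongr 1
  calc ∫⁻ y in T \ S, w y ≤ ∫⁻ y in T \ S, ENNReal.ofReal (R ^ 2 / (1 + R ^ 2)) := by
        refine setLIntegral_mono' (hT.diff hS) fun y hy ↦ ENNReal.ofReal_le_ofReal ?_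
        exact ofReal_sq_div_one_add_sq_mono (norm_nonneg y) (mem_ball_zero_iff.1 hy.1).le
    _ = ∫⁻ y in S \ T, ENNReal.ofReal (R ^ 2 / (1 + R ^ 2)) := by
        rw [setLIntegral_const, setLIntegral_const, hdiff]
    _ ≤ ∫⁻ y in S \ T, w y := by
        refine setLIntegral_mono' (hS.diff hT) fun y hy ↦ ENNReal.ofReal_le_ofReal ?_
        exact ofReal_sq_div_one_add_sq_mono hR0 (by simpa [T] using hy.2)

lemma setLIntegral_indicator_ofReal_lt (a : ℝ≥0∞) :
    ∫⁻ s in Set.Ioi (0 : ℝ), {s : ℝ | ENNReal.ofReal s < a}.indicator 1 s = a := by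
  have hm : MeasurableSet {s : ℝ | ENNReal.ofReal s < a} :=
    measurableSet_lt ENNReal.measurable_ofReal measurable_const
  rw [lintegral_indicator_one hm, Measure.restrict_apply hm]
  by_cases ha : a = ∞
  · simp [ha]
  · have : {s : ℝ | ENNReal.ofReal s < a} ∩ Set.Ioi 0 = Set.Ioo 0 a.toReal := by
      ext s
      simp only [Set.mem_inter_iff, Set.mem_ofPred_eq, Set.mem_Ioi, Set.mem_Ioo]
      constructor
      · exact fun ⟨h1, h2⟩ ↦ ⟨h2, (ENNReal.ofReal_lt_iff_lt_toReal h2.le ha).1 h1⟩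
      · exact fun ⟨h1, h2⟩ ↦ ⟨(ENNReal.ofReal_lt_iff_lt_toReal h1.le ha).2 h2, h1⟩
    rw [this, Real.volume_Ioo, sub_zero, ENNReal.ofReal_toReal ha]

/-- The rearrangement of a Lévy density is a Lévy density: by the layer-cake formula this is the
inequality for sets, integrated over the superlevel sets. -/
lemma IsLevyMeasure.rearrangement (hd : 1 ≤ d) {φ : EuclideanSpace ℝ (Fin d) → ℝ≥0∞}
    (hφ : Measurable φ) (h : IsLevyMeasure (volume.withDensity φ)) :
    IsLevyMeasure (volume.withDensity (rearrangement φ)) := by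
  have : Nonempty (Fin d) := ⟨⟨0, hd⟩⟩
  set w : EuclideanSpace ℝ (Fin d) → ℝ≥0∞ := fun y ↦ ENNReal.ofReal (‖y‖ ^ 2 / (1 + ‖y‖ ^ 2))
  have hw : Measurable w := by fun_prop
  refine ⟨withDensity_absolutelyContinuous _ _ (measure_singleton 0), lt_of_le_of_lt ?_
    h.lintegral_lt_top⟩
  have hlc : ∀ F : EuclideanSpace ℝ (Fin d) × ℝ → ℝ≥0∞, Measurable F →
      ∫⁻ y, (∫⁻ s in Set.Ioi (0 : ℝ), F (y, s)) * w y =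
        ∫⁻ s in Set.Ioi (0 : ℝ), ∫⁻ y, F (y, s) * w y := by
    intro F hF
    rw [← lintegral_lintegral_swap (by fun_prop)]
    congr with y
    rw [lintegral_mul_const _ (by fun_prop)]
  have hset : ∀ T : Set (EuclideanSpace ℝ (Fin d)), MeasurableSet T →
      ∫⁻ y, T.indicator 1 y * w y = ∫⁻ y in T, w y := by
    intro T hT
    rw [← lintegral_indicator hT]
    congr with y
    by_cases hy : y ∈ T <;> simp [hy]
  have hlev : ∀ s : ℝ, MeasurableSet {y | ENNReal.ofReal s < φ y} :=
    fun s ↦ measurableSet_lt measurable_const hφ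
  have hsymm : ∀ S : Set (EuclideanSpace ℝ (Fin d)), MeasurableSet (symmSet S) :=
    fun S ↦ measurableSet_lt measurable_volume_ball_norm measurable_const
  have hlevm : Measurable fun p : EuclideanSpace ℝ (Fin d) × ℝ ↦
      {y | ENNReal.ofReal p.2 < φ y}.indicator (1 : EuclideanSpace ℝ (Fin d) → ℝ≥0∞) p.1 := by
    have : MeasurableSet {p : EuclideanSpace ℝ (Fin d) × ℝ | ENNReal.ofReal p.2 < φ p.1} :=
      measurableSet_lt (by fun_prop) (by fun_prop)
    exact measurable_one.indicator this
  calc ∫⁻ y, w y ∂(volume.withDensity (LevySymm.rearrangement φ))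
      = ∫⁻ y, LevySymm.rearrangement φ y * w y :=
        lintegral_withDensity_eq_lintegral_mul _ (measurable_rearrangement φ) hw
    _ = ∫⁻ s in Set.Ioi (0 : ℝ), ∫⁻ y in symmSet {y | ENNReal.ofReal s < φ y}, w y := by
        refine (hlc _ (measurable_indicator_symmSet φ)).trans ?_
        simp only [hset _ (hsymm _)]
    _ ≤ ∫⁻ s in Set.Ioi (0 : ℝ), ∫⁻ y in {y | ENNReal.ofReal s < φ y}, w y :=
        lintegral_mono fun s ↦ setLIntegral_symmSet_le hd (hlev s)
    _ = ∫⁻ y, φ y * w y := by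
        have := hlc _ hlevm
        simp only [hset _ (hlev _)] at this
        rw [← this]
        congr with y
        congr 1
        exact setLIntegral_indicator_ofReal_lt (φ y)
    _ = ∫⁻ y, w y ∂(volume.withDensity φ) :=
        (lintegral_withDensity_eq_lintegral_mul _ hφ hw).symm

end Rearrangement

/-! ### Characteristic exponents -/

section Exponents

variable {d : ℕ}

lemma norm_exp_sub_one_sub_le (u : ℝ) :
    ‖Complex.exp (Complex.I * u) - 1 - Complex.I * u‖ ≤ 3 * u ^ 2 := by
  have hn : ‖Complex.I * (u : ℂ)‖ = |u| := by simp
  obtain h | h := le_total |u| 1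
  · have := Complex.norm_exp_sub_one_sub_id_le (x := Complex.I * u) (by rwa [hn])
    rw [hn, sq_abs] at this
    nlinarith [sq_nonneg u]
  · have h1 : ‖Complex.exp (Complex.I * u)‖ = 1 := by
      rw [mul_comm, Complex.norm_exp_ofReal_mul_I]
    calc _ ≤ ‖Complex.exp (Complex.I * u) - 1‖ + ‖Complex.I * (u : ℂ)‖ := norm_sub_le _ _
      _ ≤ (‖Complex.exp (Complex.I * u)‖ + ‖(1 : ℂ)‖) + ‖Complex.I * (u : ℂ)‖ := by
        gcongr
        exact norm_sub_le _ _
      _ = 2 + |u| := by rw [h1, hn, norm_one]; norm_num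
      _ ≤ 3 * u ^ 2 := by rw [← sq_abs]; nlinarith

/-- The integrand `1 + i⟨ξ,y⟩ 1_{|y|<1} - e^{i⟨ξ,y⟩}` of `charExponent`, kept definitionally equal
to it. -/
noncomputable def levyKernel (ξ y : EuclideanSpace ℝ (Fin d)) : ℂ :=
  1 + Complex.I *
    (((Metric.ball (0 : EuclideanSpace ℝ (Fin d)) 1).indicator (fun y ↦ inner ℝ ξ y) y : ℝ) : ℂ)
    - Complex.exp (Complex.I * (inner ℝ ξ y : ℝ))

lemma measurable_levyKernel (ξ : EuclideanSpace ℝ (Fin d)) : Measurable (levyKernel ξ) := by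
  have : Measurable ((Metric.ball (0 : EuclideanSpace ℝ (Fin d)) 1).indicator
      fun y ↦ (inner ℝ ξ y : ℝ)) := Measurable.indicator (by fun_prop) measurableSet_ball
  unfold levyKernel
  fun_prop

/-- The kernel is bounded at infinity and, thanks to the compensating term, quadratic at `0`; so the
condition defining Lévy measures makes it integrable. -/
lemma norm_levyKernel_le (ξ y : EuclideanSpace ℝ (Fin d)) :
    ‖levyKernel ξ y‖ ≤ (4 + 6 * ‖ξ‖ ^ 2) * (‖y‖ ^ 2 / (1 + ‖y‖ ^ 2)) := by
  rw [← mul_div_assoc, le_div_iff₀ (by positivity)]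
  by_cases hy : y ∈ Metric.ball (0 : EuclideanSpace ℝ (Fin d)) 1
  · have h1 : ‖y‖ ^ 2 ≤ 1 := pow_le_one₀ (norm_nonneg y) (mem_ball_zero_iff.1 hy).le
    have h2 : ‖levyKernel ξ y‖ ≤ 3 * (‖ξ‖ ^ 2 * ‖y‖ ^ 2) := by
      rw [levyKernel, Set.indicator_of_mem hy, ← norm_neg]
      calc _ = ‖Complex.exp (Complex.I * (inner ℝ ξ y : ℝ)) - 1
              - Complex.I * (inner ℝ ξ y : ℝ)‖ := by congr 1; ring
        _ ≤ 3 * (inner ℝ ξ y) ^ 2 := norm_exp_sub_one_sub_le _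
        _ ≤ 3 * (‖ξ‖ ^ 2 * ‖y‖ ^ 2) := by
          rw [← mul_pow, ← sq_abs]
          gcongr
          exact abs_real_inner_le_norm ξ y
    nlinarith [mul_nonneg (sq_nonneg ‖ξ‖) (sq_nonneg ‖y‖), norm_nonneg (levyKernel ξ y)]
  · have h1 : 1 ≤ ‖y‖ ^ 2 := one_le_pow₀ (by simpa using hy)
    have h2 : ‖levyKernel ξ y‖ ≤ 2 := by
      rw [levyKernel, Set.indicator_of_notMem hy]
      refine (norm_sub_le _ _).trans ?_
      rw [mul_comm Complex.I ((inner ℝ ξ y : ℝ) : ℂ), Complex.norm_exp_ofReal_mul_I]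
      norm_num
    nlinarith [mul_nonneg (sq_nonneg ‖ξ‖) (sq_nonneg ‖y‖), norm_nonneg (levyKernel ξ y)]

lemma IsLevyMeasure.integrable_levyKernel {ν : Measure (EuclideanSpace ℝ (Fin d))}
    (hν : IsLevyMeasure ν) (ξ : EuclideanSpace ℝ (Fin d)) : Integrable (levyKernel ξ) ν := by
  have h : Integrable (fun y : EuclideanSpace ℝ (Fin d) ↦ ‖y‖ ^ 2 / (1 + ‖y‖ ^ 2)) ν := by
    have hm : Measurable fun y : EuclideanSpace ℝ (Fin d) ↦ ‖y‖ ^ 2 / (1 + ‖y‖ ^ 2) := by fun_prop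
    refine ⟨hm.aestronglyMeasurable, ?_⟩
    rw [hasFiniteIntegral_iff_ofReal (ae_of_all _ fun y ↦ by positivity)]
    exact hν.lintegral_lt_top
  exact (h.const_mul (4 + 6 * ‖ξ‖ ^ 2)).mono' (measurable_levyKernel ξ).aestronglyMeasurable
    (ae_of_all _ fun y ↦ norm_levyKernel_le ξ y)

/-- A Lévy density may be infinite at the origin, but only on a null set. -/
lemma IsLevyMeasure.ae_lt_top (hd : 1 ≤ d) {φ : EuclideanSpace ℝ (Fin d) → ℝ≥0∞}
    (hφ : Measurable φ) (h : IsLevyMeasure (volume.withDensity φ)) : ∀ᵐ y, φ y < ∞ := by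
  have : Nonempty (Fin d) := ⟨⟨0, hd⟩⟩
  have hw : Measurable fun y : EuclideanSpace ℝ (Fin d) ↦
      ENNReal.ofReal (‖y‖ ^ 2 / (1 + ‖y‖ ^ 2)) := by fun_prop
  have h1 := h.lintegral_lt_top
  rw [lintegral_withDensity_eq_lintegral_mul _ hφ hw] at h1
  have h0 : ∀ᵐ y : EuclideanSpace ℝ (Fin d), y ≠ 0 := by
    simp [ae_iff, measure_singleton]
  filter_upwards [MeasureTheory.ae_lt_top (hφ.mul hw) h1.ne, h0] with y hy hy0
  by_contra hφy
  rw [not_lt_top_iff] at hφy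
  have : 0 < ‖y‖ := norm_pos_iff.2 hy0
  rw [Pi.mul_apply, hφy, ENNReal.top_mul (ENNReal.ofReal_pos.2 (by positivity)).ne'] at hy
  exact hy.ne rfl

/-- Integrals against an increasing sequence of densities converge. -/
lemma tendsto_integral_withDensity {α : Type*} [MeasurableSpace α] {μ : Measure α}
    {f : ℕ → α → ℝ≥0∞} {g : α → ℝ≥0∞} (hf : ∀ n, Measurable (f n)) (hg : Measurable g)
    (hgt : ∀ᵐ y ∂μ, g y < ∞) (hfg : ∀ n, f n ≤ g)
    (h : ∀ᵐ y ∂μ, Tendsto (fun n ↦ f n y) atTop (𝓝 (g y))) {k : α → ℂ} (hk : Measurable k)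
    (hki : Integrable k (μ.withDensity g)) :
    Tendsto (fun n ↦ ∫ y, k y ∂(μ.withDensity (f n))) atTop (𝓝 (∫ y, k y ∂(μ.withDensity g))) := by
  have hft : ∀ n, ∀ᵐ y ∂μ, f n y < ∞ := fun n ↦ by
    filter_upwards [hgt] with y hy using (hfg n y).trans_lt hy
  rw [integral_withDensity_eq_integral_toReal_smul hg hgt]
  simp only [fun n ↦ integral_withDensity_eq_integral_toReal_smul (hf n) (hft n) k]
  rw [integrable_withDensity_iff_integrable_smul' hg hgt] at hki
  refine tendsto_integral_of_dominated_convergence _ (fun n ↦ ?_) hki.norm (fun n ↦ ?_) ?_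
  · exact ((hf n).ennreal_toReal.smul hk).aestronglyMeasurable
  · filter_upwards [hgt] with y hy
    rw [norm_smul, norm_smul, Real.norm_of_nonneg ENNReal.toReal_nonneg,
      Real.norm_of_nonneg ENNReal.toReal_nonneg]
    gcongr
    exacts [hy.ne, hfg n y]
  · filter_upwards [hgt, h] with y hy hy'
    exact ((ENNReal.tendsto_toReal hy.ne).comp hy').smul_const _

/-- Convergence of characteristic exponents, for convergent diffusion matrices and increasing
Lévy densities. -/
lemma tendsto_charExponent (hd : 1 ≤ d) (b : EuclideanSpace ℝ (Fin d))
    {A : ℕ → Matrix (Fin d) (Fin d) ℝ} {A' : Matrix (Fin d) (Fin d) ℝ}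
    (hA : Tendsto A atTop (𝓝 A')) {f : ℕ → EuclideanSpace ℝ (Fin d) → ℝ≥0∞}
    {g : EuclideanSpace ℝ (Fin d) → ℝ≥0∞} (hf : ∀ n, Measurable (f n)) (hg : Measurable g)
    (hν : IsLevyMeasure (volume.withDensity g)) (hfg : ∀ n, f n ≤ g)
    (h : ∀ᵐ y, Tendsto (fun n ↦ f n y) atTop (𝓝 (g y))) (ξ : EuclideanSpace ℝ (Fin d)) :
    Tendsto (fun n ↦ charExponent b (A n) (volume.withDensity (f n)) ξ) atTop
      (𝓝 (charExponent b A' (volume.withDensity g) ξ)) := by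
  have hq : Continuous fun M : Matrix (Fin d) (Fin d) ℝ ↦
      (((ξ.ofLp ⬝ᵥ M *ᵥ ξ.ofLp : ℝ)) : ℂ) := by fun_prop
  exact ((((hq.tendsto A').comp hA).const_mul _).const_add _).add
    (tendsto_integral_withDensity hf hg (hν.ae_lt_top hd hg) hfg h (measurable_levyKernel ξ)
      (hν.integrable_levyKernel ξ))

/-- For a finite Lévy measure the compensating term of the exponent is a drift. -/
lemma charExponent_of_isFiniteMeasure (b : EuclideanSpace ℝ (Fin d))
    (A : Matrix (Fin d) (Fin d) ℝ) (ν : Measure (EuclideanSpace ℝ (Fin d))) [IsFiniteMeasure ν]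
    (ξ : EuclideanSpace ℝ (Fin d)) :
    charExponent b A ν ξ = ∫ y, (1 - Complex.exp (Complex.I * (inner ℝ ξ y : ℝ))) ∂ν +
      (-Complex.I * (inner ℝ (b - ∫ y in Metric.ball (0 : EuclideanSpace ℝ (Fin d)) 1, y ∂ν) ξ : ℝ)
        + (1 / 2 : ℂ) * ((ξ.ofLp ⬝ᵥ A *ᵥ ξ.ofLp : ℝ) : ℂ)) := by
  have hB : IntegrableOn (fun y : EuclideanSpace ℝ (Fin d) ↦ y) (Metric.ball 0 1) ν := by
    refine Integrable.of_bound (by fun_prop) 1 ?_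
    filter_upwards [ae_restrict_mem measurableSet_ball] with y hy
    exact (mem_ball_zero_iff.1 hy).le
  have hi : Integrable ((Metric.ball (0 : EuclideanSpace ℝ (Fin d)) 1).indicator
      fun y ↦ (inner ℝ ξ y : ℝ)) ν :=
    (integrable_indicator_iff measurableSet_ball).2 (hB.const_inner ξ)
  have he : Integrable (fun y ↦ 1 - Complex.exp (Complex.I * (inner ℝ ξ y : ℝ))) ν := by
    refine (integrable_const 1).sub (Integrable.of_bound (by fun_prop) 1 (ae_of_all _ fun y ↦ ?_))
    rw [mul_comm, Complex.norm_exp_ofReal_mul_I]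
  have hi' : Integrable (fun y ↦ Complex.I *
      (((Metric.ball (0 : EuclideanSpace ℝ (Fin d)) 1).indicator
        (fun y ↦ inner ℝ ξ y) y : ℝ) : ℂ)) ν := hi.ofReal.const_mul Complex.I
  have hI : ∫ y, (Metric.ball (0 : EuclideanSpace ℝ (Fin d)) 1).indicator
      (fun y ↦ (inner ℝ ξ y : ℝ)) y ∂ν =
      inner ℝ ξ (∫ y in Metric.ball (0 : EuclideanSpace ℝ (Fin d)) 1, y ∂ν) := by
    rw [integral_indicator measurableSet_ball]
    exact integral_inner hB ξ
  have hsum : ∫ y, (1 + Complex.I *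
        (((Metric.ball (0 : EuclideanSpace ℝ (Fin d)) 1).indicator (fun y ↦ inner ℝ ξ y) y : ℝ) : ℂ)
        - Complex.exp (Complex.I * (inner ℝ ξ y : ℝ))) ∂ν =
      ∫ y, (1 - Complex.exp (Complex.I * (inner ℝ ξ y : ℝ))) ∂ν + Complex.I *
        ((inner ℝ ξ (∫ y in Metric.ball (0 : EuclideanSpace ℝ (Fin d)) 1, y ∂ν) : ℝ) : ℂ) := by
    rw [← hI, ← integral_complex_ofReal, ← integral_const_mul,
      ← integral_add he hi']
    refine integral_congr_ae (ae_of_all _ fun y ↦ ?_)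
    simp only
    ring
  rw [charExponent, hsum, inner_sub_left, real_inner_comm ξ (∫ y in _, y ∂ν)]
  push_cast
  ring

/-- The compensating drift of a symmetric density vanishes. -/
lemma setIntegral_ball_eq_zero_of_even {f : EuclideanSpace ℝ (Fin d) → ℝ≥0∞}
    (hf : Measurable f) (heven : ∀ y, f (-y) = f y) [IsFiniteMeasure (volume.withDensity f)] :
    ∫ y in Metric.ball (0 : EuclideanSpace ℝ (Fin d)) 1, y ∂(volume.withDensity f) = 0 := by
  have hlt : ∀ᵐ y, f y < ∞ := by
    refine ae_lt_top hf ?_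
    have := measure_ne_top (volume.withDensity f) Set.univ
    rwa [withDensity_apply _ MeasurableSet.univ, setLIntegral_univ] at this
  rw [← integral_indicator measurableSet_ball, integral_withDensity_eq_integral_toReal_smul hf hlt]
  have := IsAddTorsionFree.of_module_rat (EuclideanSpace ℝ (Fin d))
  refine self_eq_neg.1 ?_
  rw [← integral_neg, ← integral_neg_eq_self]
  congr with y : 1
  rw [heven, ← smul_neg]
  congr 1
  by_cases hy : y ∈ Metric.ball (0 : EuclideanSpace ℝ (Fin d)) 1
  · rw [Set.indicator_of_mem hy, Set.indicator_of_mem (by simpa using hy)]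
  · rw [Set.indicator_of_notMem hy, Set.indicator_of_notMem (by simpa using hy), neg_zero]

end Exponents

/-! ### Sums of compound Poisson and Gaussian processes -/

section Sum

variable {d : ℕ} {Ω : Type*} [MeasurableSpace Ω] {P : Measure Ω}
  {Z : ℝ≥0 → Ω → EuclideanSpace ℝ (Fin d)} {x b : EuclideanSpace ℝ (Fin d)}
  {A : Matrix (Fin d) (Fin d) ℝ} {ν : Measure (EuclideanSpace ℝ (Fin d))}

lemma IsGaussianLevyProcess.hasExponent [IsProbabilityMeasure P]
    (hZ : IsGaussianLevyProcess Z x b A P) (hA : A.PosSemidef) :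
    HasExponent Z (fun ξ ↦ -Complex.I * (inner ℝ b ξ : ℝ) +
      (1 / 2 : ℂ) * ((ξ.ofLp ⬝ᵥ A *ᵥ ξ.ofLp : ℝ) : ℂ)) P := by
  refine hZ.toIsLevyProcess.hasExponent fun t ξ ↦ ?_
  -- `multivariateGaussian` has a junk value unless its covariance matrix is nonnegative.
  have hAt : ((t : ℝ) • A).PosSemidef := hA.smul t.2
  rw [(hZ.hasLaw t).map_eq, charFun_multivariateGaussian hAt]
  congr 1
  rw [inner_add_right, inner_smul_right, Matrix.smul_mulVec, dotProduct_smul,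
    real_inner_comm b ξ]
  push_cast
  simp only [smul_eq_mul]
  push_cast
  ring

lemma IsPoissonGaussianSum.measurable (hZ : IsPoissonGaussianSum Z x b A ν P) (t : ℝ≥0) :
    Measurable (Z t) := by
  obtain ⟨C, G, hC, hG, -, hsum⟩ := hZ
  rw [show Z t = _ from funext fun ω ↦ hsum t ω]
  exact (hC.measurable t).add (hG.measurable t)

lemma IsPoissonGaussianSum.start (hZ : IsPoissonGaussianSum Z x b A ν P) :
    ∀ᵐ ω ∂P, Z 0 ω = x := by
  obtain ⟨C, G, hC, hG, -, hsum⟩ := hZ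
  filter_upwards [hC.start, hG.start] with ω h1 h2
  rw [hsum, h1, h2, zero_add]

lemma IsPoissonGaussianSum.isFiniteMeasure (hZ : IsPoissonGaussianSum Z x b A ν P) :
    IsFiniteMeasure ν := by
  obtain ⟨C, G, hC, -⟩ := hZ
  exact hC.isFiniteMeasure

/-- A sum of independent compound Poisson and Gaussian processes has the characteristic exponent
whose compensating drift makes up for the drift of the Gaussian part. -/
lemma IsPoissonGaussianSum.hasExponent [IsProbabilityMeasure P] {a : EuclideanSpace ℝ (Fin d)}
    (hZ : IsPoissonGaussianSum Z x b A ν P) (hA : A.PosSemidef)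
    (hb : b = a - ∫ y in Metric.ball (0 : EuclideanSpace ℝ (Fin d)) 1, y ∂ν) :
    HasExponent Z (charExponent a A ν) P := by
  have := hZ.isFiniteMeasure
  obtain ⟨C, G, hC, hG, hind, hsum⟩ := hZ
  have h := hC.hasExponent.add (hG.hasExponent hA) hC.measurable hG.measurable hind
  have e : Z = fun t ω ↦ C t ω + G t ω := by
    ext1 t
    ext1 ω
    exact hsum t ω
  rw [e]
  convert h using 2 with ξ
  rw [charExponent_of_isFiniteMeasure, ← hb]

end Sum

/-! ### Truncated densities and symmetrized matrices -/

section Truncation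

variable {d : ℕ} {φ : EuclideanSpace ℝ (Fin d) → ℝ≥0∞}

lemma measurable_truncDensity (hφ : Measurable φ) (n : ℕ) : Measurable (truncDensity φ n) :=
  hφ.indicator (measurableSet_lt measurable_const measurable_norm)

lemma truncDensity_le (φ : EuclideanSpace ℝ (Fin d) → ℝ≥0∞) (n : ℕ) : truncDensity φ n ≤ φ :=
  Set.indicator_le_self _ _

/-- The shift by one is needed: since `1 / 0 = 0`, the truncation at `n = 0` removes only the
origin. -/
lemma monotone_truncDensity_succ (φ : EuclideanSpace ℝ (Fin d) → ℝ≥0∞) :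
    Monotone fun n ↦ truncDensity φ (n + 1) := by
  intro k l hkl
  refine Set.indicator_le_indicator_of_subset (fun y (hy : 1 / ((k + 1 : ℕ) : ℝ) < ‖y‖) ↦ ?_)
    (fun _ ↦ zero_le)
  change 1 / ((l + 1 : ℕ) : ℝ) < ‖y‖
  refine lt_of_le_of_lt ?_ hy
  exact one_div_le_one_div_of_le (by positivity) (by exact_mod_cast Nat.succ_le_succ hkl)

lemma ae_tendsto_truncDensity_succ (hd : 1 ≤ d) (φ : EuclideanSpace ℝ (Fin d) → ℝ≥0∞) :
    ∀ᵐ y, Tendsto (fun n ↦ truncDensity φ (n + 1) y) atTop (𝓝 (φ y)) := by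
  have : Nonempty (Fin d) := ⟨⟨0, hd⟩⟩
  have h0 : ∀ᵐ y : EuclideanSpace ℝ (Fin d), y ≠ 0 := by
    simp [ae_iff, measure_singleton]
  filter_upwards [h0] with y hy
  refine tendsto_const_nhds.congr' ?_
  have h1 : Tendsto (fun n : ℕ ↦ 1 / ((n + 1 : ℕ) : ℝ)) atTop (𝓝 0) :=
    (tendsto_add_atTop_iff_nat 1).2 tendsto_one_div_atTop_nhds_zero_nat
  filter_upwards [h1.eventually (gt_mem_nhds (norm_pos_iff.2 hy))] with n hn
  exact (Set.indicator_of_mem (show y ∈ {y | 1 / ((n + 1 : ℕ) : ℝ) < ‖y‖} from hn) φ).symm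

lemma continuous_symmMatrix :
    Continuous (symmMatrix : Matrix (Fin d) (Fin d) ℝ → Matrix (Fin d) (Fin d) ℝ) := by
  have h : Continuous fun A : Matrix (Fin d) (Fin d) ℝ ↦ A.det ^ (1 / (d : ℝ)) :=
    (continuous_id.matrix_det).rpow_const fun _ ↦ Or.inr (by positivity)
  exact h.smul continuous_const

lemma posSemidef_symmMatrix {A : Matrix (Fin d) (Fin d) ℝ} (hA : A.PosSemidef) :
    (symmMatrix A).PosSemidef :=
  Matrix.PosSemidef.one.smul (Real.rpow_nonneg hA.det_nonneg _)

end Truncation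

end LevySymm

/-! ### Convergence of the approximating processes -/

theorem theorem4p1 {d : ℕ} (hd : 1 ≤ d)
    -- the characteristics of the Lévy process, with an absolutely continuous Lévy measure
    (b : EuclideanSpace ℝ (Fin d)) (A : Matrix (Fin d) (Fin d) ℝ) (hA : A.PosSemidef)
    (φ : EuclideanSpace ℝ (Fin d) → ℝ≥0∞) (hφ : Measurable φ)
    (hν : LevySymm.IsLevyMeasure (volume.withDensity φ))
    (ε : ℕ → ℝ) (hε : ∀ n, 1 ≤ n → 0 < ε n) (hε0 : Tendsto ε atTop (𝓝 0))
    -- the starting point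
    (x : EuclideanSpace ℝ (Fin d))
    -- the Lévy process and its symmetrization
    {Ω : Type*} [MeasurableSpace Ω] (P : Measure Ω) [IsProbabilityMeasure P]
    (X : ℝ≥0 → Ω → EuclideanSpace ℝ (Fin d))
    (hX : LevySymm.IsLevyProcessWith X x b A (volume.withDensity φ) P)
    {Ω' : Type*} [MeasurableSpace Ω'] (P' : Measure Ω') [IsProbabilityMeasure P']
    (X' : ℝ≥0 → Ω' → EuclideanSpace ℝ (Fin d))
    (hX' : LevySymm.IsLevyProcessWith X' x 0 (LevySymm.symmMatrix A)
      (volume.withDensity (LevySymm.rearrangement φ)) P')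
    -- the approximating processes, for `n ≥ 1`
    {Γ : ℕ → Type*} [∀ n, MeasurableSpace (Γ n)] (Q : ∀ n, Measure (Γ n))
    [∀ n, IsProbabilityMeasure (Q n)]
    (Xn : ∀ n, ℝ≥0 → Γ n → EuclideanSpace ℝ (Fin d))
    (hXn : ∀ n, 1 ≤ n → LevySymm.IsPoissonGaussianSum (Xn n) x (LevySymm.truncDrift b φ n)
      (A + ε n • (1 : Matrix (Fin d) (Fin d) ℝ))
      (volume.withDensity (LevySymm.truncDensity φ n)) (Q n))
    -- their symmetrizations, for `n ≥ 1`
    {Γ' : ℕ → Type*} [∀ n, MeasurableSpace (Γ' n)] (Q' : ∀ n, Measure (Γ' n))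
    [∀ n, IsProbabilityMeasure (Q' n)]
    (Xn' : ∀ n, ℝ≥0 → Γ' n → EuclideanSpace ℝ (Fin d))
    (hXn' : ∀ n, 1 ≤ n → LevySymm.IsPoissonGaussianSum (Xn' n) x 0
      (LevySymm.symmMatrix (A + ε n • (1 : Matrix (Fin d) (Fin d) ℝ)))
      (volume.withDensity (LevySymm.rearrangement (LevySymm.truncDensity φ n))) (Q' n))
    -- test functions and times
    (m : ℕ) (f : Fin m → (EuclideanSpace ℝ (Fin d) →ᵇ ℝ)) (hf : ∀ i y, 0 ≤ f i y)
    (t : Fin m → ℝ≥0) (ht0 : ∀ i, 0 < t i) (ht : StrictMono t) :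
    Tendsto (fun n ↦ ∫ ω, ∏ i, f i (Xn n (t i) ω) ∂(Q n)) atTop
        (𝓝 (∫ ω, ∏ i, f i (X (t i) ω) ∂P)) ∧
      Tendsto (fun n ↦ ∫ ω, ∏ i, f i (Xn' n (t i) ω) ∂(Q' n)) atTop
        (𝓝 (∫ ω, ∏ i, f i (X' (t i) ω) ∂P')) := by
  have hX0 := hX.toIsLevyProcess.hasExponent hX.charFun_eq
  have hX0' := hX'.toIsLevyProcess.hasExponent hX'.charFun_eq
  have hAn : ∀ n, (A + ε (n + 1) • (1 : Matrix (Fin d) (Fin d) ℝ)).PosSemidef := fun n ↦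
    hA.add (Matrix.PosSemidef.one.smul (hε _ n.succ_pos).le)
  have hlim : Tendsto (fun n ↦ A + ε (n + 1) • (1 : Matrix (Fin d) (Fin d) ℝ)) atTop (𝓝 A) := by
    simpa using (((tendsto_add_atTop_iff_nat 1).2 hε0).smul_const
      (1 : Matrix (Fin d) (Fin d) ℝ)).const_add A
  have hmono := LevySymm.monotone_truncDensity_succ φ
  have hle : ∀ n, LevySymm.truncDensity φ (n + 1) ≤ φ := fun n ↦ LevySymm.truncDensity_le φ _
  have hae := LevySymm.ae_tendsto_truncDensity_succ hd φ
  constructor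
  -- The processes are only controlled for `n ≥ 1`, hence the shift of the index.
  · rw [← tendsto_add_atTop_iff_nat 1]
    refine LevySymm.tendsto_integral_prod_of_tendsto_exponent hX.measurable hX.start hX0
      (fun n ↦ (hXn _ n.succ_pos).measurable) (fun n ↦ (hXn _ n.succ_pos).start)
      (fun n ↦ (hXn _ n.succ_pos).hasExponent (hAn n) rfl) (fun ξ ↦ ?_) f ht.monotone
    exact LevySymm.tendsto_charExponent hd b hlim
      (fun n ↦ LevySymm.measurable_truncDensity hφ _) hφ hν hle hae ξ
  · rw [← tendsto_add_atTop_iff_nat 1]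
    -- The rearranged densities are even, so no drift is needed to compensate their small jumps.
    have hdrift : ∀ n, (0 : EuclideanSpace ℝ (Fin d)) =
        0 - ∫ y in Metric.ball (0 : EuclideanSpace ℝ (Fin d)) 1, y
          ∂(volume.withDensity (LevySymm.rearrangement (LevySymm.truncDensity φ (n + 1)))) := by
      intro n
      have := (hXn' _ n.succ_pos).isFiniteMeasure
      rw [LevySymm.setIntegral_ball_eq_zero_of_even (LevySymm.measurable_rearrangement _)
        (LevySymm.rearrangement_neg _), sub_zero]
    refine LevySymm.tendsto_integral_prod_of_tendsto_exponent hX'.measurable hX'.start hX0'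
      (fun n ↦ (hXn' _ n.succ_pos).measurable) (fun n ↦ (hXn' _ n.succ_pos).start)
      (fun n ↦ (hXn' _ n.succ_pos).hasExponent (LevySymm.posSemidef_symmMatrix (hAn n)) (hdrift n))
      (fun ξ ↦ ?_) f ht.monotone
    exact LevySymm.tendsto_charExponent hd 0
      ((LevySymm.continuous_symmMatrix.tendsto A).comp hlim)
      (fun n ↦ LevySymm.measurable_rearrangement _) (LevySymm.measurable_rearrangement φ)
      (hν.rearrangement hd hφ) (fun n ↦ LevySymm.rearrangement_mono (hle n))
      (ae_of_all _ (LevySymm.tendsto_rearrangement hmono hle hae)) ξ
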